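/- Let $\mathbb R_3$ be the real Clifford algebra generated by $e_1,e_2,e_3$ with $e_j^2=-1$ and $e_ie_j=-e_je_i$ for $i\ne j$; write $e_{12}=e_1e_2$, and let $\lambda\mapsto\bar\lambda$ be the real-linear anti-automorphism of $\mathbb R_3$ with $\bar e_j=-e_j$. Let $\partial_x=\sum_{j=1}^3 e_j\,\partial_{x_j}$ be the Dirac operator on $\mathbb R^3$. For $d\ge 0$ let $\mathcal M_\ell^+(d)$ be the right $\mathbb R_3$-module of all $\mathbb R_3$-valued homogeneous polynomials $f$ of degree $d$ on $\mathbb R^3$ (together with $0$) with $\partial_x f=0$. For $x=(r\cos\theta\sin\phi,\,r\sin\theta\sin\phi,\,r\cos\phi)$ with $r\ge0$, $0\le\phi\le\pi$, and $k\ge 1$, put $$H_k^0(x)=\frac{r^k}{\sqrt{8\pi}}P_k^{(0,0)}(\cos\phi),\qquad H_k^1(x)=0,$$ $$H_k^{2n}(x)=\frac{r^k}{2^{n+1}\sqrt\pi}(\sin\phi)^nP_{k-n}^{(n,n)}(\cos\phi)\cos n\theta,\qquad H_k^{2n+1}(x)=\frac{r^k}{2^{n+1}\sqrt\pi}(\sin\phi)^nP_{k-n}^{(n,n)}(\cos\phi)\sin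 n\theta\qquad(1\le n\le k),$$ where $P_m^{(\alpha,\beta)}(t)=2^{-m}\sum_{s=0}^m\binom{m+\alpha}{m-s}\binom{m+\beta}{s}(t-1)^s(t+1)^{m-s}$ are the Jacobi polynomials. Set $Y_{k-1}^j=\partial_xH_k^j$ and $$F_{k-1}^n=Y_{k-1}^{2n}-Y_{k-1}^{2n+1}e_{12},\qquad n=0,\dots,k-1$$ (so $F_{k-1}^0=Y_{k-1}^0$). Then, for every $k\ge1$, the functions $F_{k-1}^0,\dots,F_{k-1}^{k-1}$ are pairwise orthogonal in $L^2(S^2)$, that is, $$\int_{S^2}\overline{F_{k-1}^n(\omega)}\,F_{k-1}^{n'}(\omega)\,d\omega=0\qquad(n\ne n'),$$ and they form a basis of the right $\mathbb R_3$-module $\mathcal M_\ell^+(k-1)$. -/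

import Mathlib

open MeasureTheory

noncomputable section

namespace SphMon

/-! ### The real Clifford algebra `ℝ₃` with `e_j ^ 2 = -1` -/

/-- The quadratic form `-(v₁² + v₂² + v₃²)`. -/
abbrev negDef : QuadraticForm ℝ (Fin 3 → ℝ) :=
  QuadraticMap.weightedSumSquares ℝ (fun _ : Fin 3 => (-1 : ℝ))

/-- The universal real Clifford algebra `ℝ₃`. Its `star` (Mathlib's instance) is the Hermitian
conjugation: the real-linear anti-automorphism sending every vector `v` to `-v`. -/
abbrev Cl3 : Type := CliffordAlgebra negDef

/-- The generators; `e 0, e 1, e 2` stand for `e₁, e₂, e₃`. -/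
def e (j : Fin 3) : Cl3 := CliffordAlgebra.ι negDef (Pi.single j 1)

theorem e_sq (j : Fin 3) : e j * e j = -1 := by
  unfold e
  rw [CliffordAlgebra.ι_sq_scalar]
  fin_cases j <;>
    simp [negDef, QuadraticMap.weightedSumSquares_apply, Pi.single_apply]

theorem e_anticomm {i j : Fin 3} (h : i ≠ j) : e i * e j = -(e j * e i) := by
  have key := CliffordAlgebra.ι_mul_ι_add_swap (Q := negDef) (Pi.single i 1) (Pi.single j 1)
  rw [eq_neg_iff_add_eq_zero]
  unfold e
  rw [key]
  revert h
  fin_cases i <;> fin_cases j <;>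
    simp [QuadraticMap.polar, negDef, QuadraticMap.weightedSumSquares_apply,
      Fin.sum_univ_three, Pi.single_apply]

theorem star_e (j : Fin 3) : star (e j) = -e j := CliffordAlgebra.star_ι _

/-- The standard basis `1, e₁, e₂, e₃, e₁₂, e₁₃, e₂₃, e₁₂₃` of `ℝ₃`. -/
def eBlade : Fin 8 → Cl3 :=
  ![1, e 0, e 1, e 2, e 0 * e 1, e 0 * e 2, e 1 * e 2, e 0 * e 1 * e 2]

/-- The linear map `v ↦ s (v₁ i + v₂ j + v₃ k)` into the quaternions. -/
def quatVec (s : ℝ) : (Fin 3 → ℝ) →ₗ[ℝ] QuaternionAlgebra ℝ (-1) 0 (-1) where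
  toFun v := ⟨0, s * v 0, s * v 1, s * v 2⟩
  map_add' u v := by ext <;> simp [mul_add]
  map_smul' c v := by ext <;> simp <;> ring

theorem quatVec_sq (s : ℝ) (hs : s * s = 1) (v : Fin 3 → ℝ) :
    quatVec s v * quatVec s v = algebraMap ℝ (QuaternionAlgebra ℝ (-1) 0 (-1)) (negDef v) := by
  ext <;> simp [quatVec, negDef, QuadraticMap.weightedSumSquares_apply, Fin.sum_univ_three]
  · linear_combination (-(v 0 * v 0) - v 1 * v 1 - v 2 * v 2) * hs
  all_goals ring
/-- The algebra homomorphism `ℝ₃ → ℍ` with `e₁, e₂, e₃ ↦ s i, s j, s k`, for `s = ±1`. -/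
def toQuat (s : ℝ) (hs : s * s = 1) : Cl3 →ₐ[ℝ] QuaternionAlgebra ℝ (-1) 0 (-1) :=
  CliffordAlgebra.lift negDef ⟨quatVec s, quatVec_sq s hs⟩

theorem toQuat_e (s : ℝ) (hs : s * s = 1) (j : Fin 3) :
    toQuat s hs (e j) = quatVec s (Pi.single j 1) := by
  unfold toQuat e
  exact CliffordAlgebra.lift_ι_apply _ _ _

theorem linearIndependent_eBlade : LinearIndependent ℝ eBlade := by
  rw [Fintype.linearIndependent_iff]
  intro g hg
  have h1 := congrArg (toQuat 1 (by norm_num)) hg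
  have h2 := congrArg (toQuat (-1) (by norm_num)) hg
  simp only [Fin.sum_univ_eight, eBlade] at h1 h2
  simp [toQuat_e, quatVec, QuaternionAlgebra.ext_iff] at h1 h2
  obtain ⟨a1, a2, a3, a4⟩ := h1
  obtain ⟨b1, b2, b3, b4⟩ := h2
  intro i
  fin_cases i <;> simp <;> linarith

theorem span_eBlade : ⊤ ≤ Submodule.span ℝ (Set.range eBlade) := by
  set S := Submodule.span ℝ (Set.range eBlade) with hS
  have hb : ∀ i, eBlade i ∈ S := fun i => Submodule.subset_span ⟨i, rfl⟩
  have h00 := e_sq 0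
  have h11 := e_sq 1
  have h22 := e_sq 2
  have h10 : e 1 * e 0 = -(e 0 * e 1) := e_anticomm (by decide)
  have h20 : e 2 * e 0 = -(e 0 * e 2) := e_anticomm (by decide)
  have h21 : e 2 * e 1 = -(e 1 * e 2) := e_anticomm (by decide)
  have c00 : ∀ z, e 0 * (e 0 * z) = -z := fun z => by rw [← mul_assoc, h00]; simp
  have c11 : ∀ z, e 1 * (e 1 * z) = -z := fun z => by rw [← mul_assoc, h11]; simp
  have c10 : ∀ z, e 1 * (e 0 * z) = -(e 0 * (e 1 * z)) := fun z => by
    rw [← mul_assoc, h10]; simp [mul_assoc]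
  have c20 : ∀ z, e 2 * (e 0 * z) = -(e 0 * (e 2 * z)) := fun z => by
    rw [← mul_assoc, h20]; simp [mul_assoc]
  have c21 : ∀ z, e 2 * (e 1 * z) = -(e 1 * (e 2 * z)) := fun z => by
    rw [← mul_assoc, h21]; simp [mul_assoc]
  have m0 : (1 : Cl3) ∈ S := hb 0
  have m1 : e 0 ∈ S := hb 1
  have m2 : e 1 ∈ S := hb 2
  have m3 : e 2 ∈ S := hb 3
  have m4 : e 0 * e 1 ∈ S := hb 4
  have m5 : e 0 * e 2 ∈ S := hb 5
  have m6 : e 1 * e 2 ∈ S := hb 6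
  have m7 : e 0 * (e 1 * e 2) ∈ S := by rw [← mul_assoc]; exact hb 7
  have hmul : ∀ j, ∀ x ∈ S, e j * x ∈ S := by
    intro j x hx
    induction hx using Submodule.span_induction with
    | mem x hx =>
      obtain ⟨i, rfl⟩ := hx
      fin_cases j <;> fin_cases i <;>
        simp [eBlade, mul_assoc, h00, h11, h22, h10, h20, h21, c00, c11, c10, c20, c21,
          m0, m1, m2, m3, m4, m5, m6, m7]
    | zero => simp
    | add x y _ _ hx hy => rw [mul_add]; exact S.add_mem hx hy
    | smul a x _ hx => rw [mul_smul_comm]; exact S.smul_mem a hx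
  intro x _
  induction x using CliffordAlgebra.left_induction with
  | algebraMap r =>
    rw [Algebra.algebraMap_eq_smul_one]
    exact S.smul_mem r m0
  | add x y hx hy => exact S.add_mem (hx trivial) (hy trivial)
  | ι_mul x m hx =>
    have hm : CliffordAlgebra.ι negDef m = ∑ j, m j • e j := by
      conv_lhs => rw [← Finset.univ_sum_single m]
      rw [map_sum]
      refine Finset.sum_congr rfl fun j _ => ?_
      rw [e, ← map_smul, ← Pi.single_smul, smul_eq_mul, mul_one]
    rw [hm, Finset.sum_mul]
    refine S.sum_mem fun j _ => ?_
    rw [smul_mul_assoc]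
    exact S.smul_mem _ (hmul j _ (hx trivial))

/-- `1, e₁, e₂, e₃, e₁₂, e₁₃, e₂₃, e₁₂₃` as a real basis of `ℝ₃`. -/
def bladeBasis : Module.Basis (Fin 8) ℝ Cl3 :=
  Module.Basis.mk linearIndependent_eBlade span_eBlade

/-- The coordinates `(λ_A)_A` of a Clifford number, as a vector of Euclidean space. -/
def coords : Cl3 →ₗ[ℝ] EuclideanSpace ℝ (Fin 8) :=
  ((WithLp.linearEquiv 2 ℝ (Fin 8 → ℝ)).symm.toLinearMap).comp bladeBasis.equivFun.toLinearMap

theorem coords_injective : Function.Injective coords :=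
  (WithLp.linearEquiv 2 ℝ (Fin 8 → ℝ)).symm.injective.comp bladeBasis.equivFun.injective

/-- The norm `|λ|² = ∑_A λ_A²` on `ℝ₃`. -/
instance : NormedAddCommGroup Cl3 :=
  NormedAddCommGroup.induced Cl3 (EuclideanSpace ℝ (Fin 8)) coords coords_injective

instance : NormedSpace ℝ Cl3 :=
  NormedSpace.induced ℝ Cl3 (EuclideanSpace ℝ (Fin 8)) coords

instance : FiniteDimensional ℝ Cl3 := bladeBasis.finiteDimensional_of_finite

/-! ### The Dirac operator and spherical monogenics on `ℝ³` -/

/-- Euclidean three-space; `x 0, x 1, x 2` stand for `x₁, x₂, x₃`. -/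
abbrev E3 : Type := EuclideanSpace ℝ (Fin 3)

/-- The Dirac operator `∂ₓ f = ∑_j e_j ∂f/∂x_j`. -/
def dirac (f : E3 → Cl3) (x : E3) : Cl3 :=
  ∑ j, e j * fderiv ℝ f x (EuclideanSpace.single j 1)

/-- Left monogenic functions on `ℝ³`. -/
def IsLeftMonogenic (f : E3 → Cl3) : Prop :=
  ContDiff ℝ 1 f ∧ ∀ x, dirac f x = 0

/-- `f(x) = ∑_{|α| = d} x^α c_α` with coefficients `c_α ∈ ℝ₃`. -/
def IsHomogPoly (d : ℕ) (f : E3 → Cl3) : Prop :=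
  ∃ c : (Fin 3 → ℕ) → Cl3, ∀ x : E3,
    f x = ∑ α ∈ Finset.piAntidiag Finset.univ d, (∏ i, x i ^ α i) • c α

/-- Right multiplication by `a`, as a continuous real-linear map. -/
def mulRightL (a : Cl3) : Cl3 →L[ℝ] Cl3 :=
  LinearMap.toContinuousLinearMap (LinearMap.mulRight ℝ a)

/-- The right `ℝ₃`-module of left monogenic homogeneous polynomials of degree `d` on `ℝ³`
(a right module is a module over the opposite ring, `MulOpposite.op a` acting by `f ↦ f a`). -/
def monogenics (d : ℕ) : Submodule Cl3ᵐᵒᵖ (E3 → Cl3) where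
  carrier := {f | IsHomogPoly d f ∧ IsLeftMonogenic f}
  zero_mem' := by
    refine ⟨⟨fun _ => 0, fun x => by simp⟩, contDiff_const, fun x => ?_⟩
    have h : fderiv ℝ (0 : E3 → Cl3) x = 0 := fderiv_const_apply (0 : Cl3)
    simp [dirac, h]
  add_mem' := by
    rintro f g ⟨⟨c, hc⟩, hf1, hf2⟩ ⟨⟨c', hc'⟩, hg1, hg2⟩
    refine ⟨⟨fun α => c α + c' α, fun x => ?_⟩, hf1.add hg1, fun x => ?_⟩
    · simp [hc, hc', Finset.sum_add_distrib]
    · have h := fderiv_add (hf1.differentiable one_ne_zero x)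
        (hg1.differentiable one_ne_zero x)
      have h2 := hf2 x
      have h3 := hg2 x
      unfold dirac at *
      simp only [h, add_apply, mul_add, Finset.sum_add_distrib, h2, h3,
        add_zero]
  smul_mem' := by
    rintro a f ⟨⟨c, hc⟩, hf1, hf2⟩
    have ha : a • f = fun x => mulRightL a.unop (f x) := rfl
    refine ⟨⟨fun α => c α * a.unop, fun x => ?_⟩, ?_, fun x => ?_⟩
    · change f x * a.unop = _
      simp [hc, Finset.sum_mul]
    · rw [ha]
      exact (mulRightL a.unop).contDiff.comp hf1
    · have h : fderiv ℝ (a • f) x = (mulRightL a.unop).comp (fderiv ℝ f x) := by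
        rw [ha]
        exact ((mulRightL a.unop).hasFDerivAt.comp x
          (hf1.differentiable one_ne_zero x).hasFDerivAt).fderiv
      have h2 := hf2 x
      unfold dirac at *
      rw [h]
      have h3 : ∀ y, mulRightL a.unop y = y * a.unop := fun y => rfl
      simp only [ContinuousLinearMap.comp_apply, h3, ← mul_assoc, ← Finset.sum_mul, h2, zero_mul]

/-! ### The spherical harmonics and the functions built from them -/

/-- The Jacobi polynomial `P_m^{(a,b)}(t)`, for natural parameters `a` and `b`. -/
def jacobiP (m a b : ℕ) (t : ℝ) : ℝ :=
  (2 : ℝ)⁻¹ ^ m * ∑ s ∈ Finset.range (m + 1),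
    ((m + a).choose (m - s) : ℝ) * ((m + b).choose s : ℝ) * (t - 1) ^ s * (t + 1) ^ (m - s)

/-- The polar angle `φ ∈ [0, π]` of `x = (r cos θ sin φ, r sin θ sin φ, r cos φ)`. -/
def polar (x : E3) : ℝ := Real.arccos (x 2 / ‖x‖)

/-- The azimuthal angle `θ`, taken in `(-π, π]`. -/
def azimuth (x : E3) : ℝ := Complex.arg ⟨x 0, x 1⟩

/-- The spherical harmonic `H_k^j`, for `j = 0`, `j = 2n` and `j = 2n + 1`. The last formula at
`n = 0` gives `H_k^1 = 0`. -/
def harmonic (k j : ℕ) (x : E3) : ℝ :=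
  if j = 0 then
    ‖x‖ ^ k / √(8 * Real.pi) * jacobiP k 0 0 (Real.cos (polar x))
  else
    ‖x‖ ^ k / (2 ^ (j / 2 + 1) * √Real.pi) * Real.sin (polar x) ^ (j / 2) *
      jacobiP (k - j / 2) (j / 2) (j / 2) (Real.cos (polar x)) *
      (if Even j then Real.cos ((j / 2 : ℕ) * azimuth x)
        else Real.sin ((j / 2 : ℕ) * azimuth x))

/-- `Y_{k-1}^j = ∂ₓ H_k^j`. -/
def diracHarmonic (k j : ℕ) : E3 → Cl3 :=
  dirac fun x => algebraMap ℝ Cl3 (harmonic k j x)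

/-- `F_{k-1}^n = Y_{k-1}^{2n} - Y_{k-1}^{2n+1} e₁₂`. -/
def monogenicF (k n : ℕ) (x : E3) : Cl3 :=
  diracHarmonic k (2 * n) x - diracHarmonic k (2 * n + 1) x * (e 0 * e 1)

/-- The surface measure of the unit sphere `S²`. -/
abbrev surfaceMeasure : Measure (Metric.sphere (0 : E3) 1) := (volume : Measure E3).toSphere

end SphMon

end

/-!
Write `ζ = x₁ + i x₂` and embed `ℂ` into `ℝ₃` by `i ↦ e₁₂`. The coefficients of the powers of the
polynomial `ζ̄ X² + x₃ X - ζ / 4` are the solid harmonics `H_k^{2n} - i H_k^{2n+1}` up to a nonzero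
real factor, because at `ζ ≠ 0` the polynomial is a rescaling of a product
`(X + r (cos φ + 1) / 2) (X + r (cos φ - 1) / 2)`, whose powers have Jacobi polynomials as
coefficients. Hence `F_d^n` is a nonzero real multiple of `G_d^n`, the Clifford gradient of such a
coefficient.

With the factorials chosen suitably, `∂₃ G_{d+1}^n = G_d^n` for `n ≤ d` while `∂₃ G_{d+1}^{d+1} = 0`
(the Appell property). Since `∂₃` maps monogenics of degree `d + 1` to monogenics of degree `d`,
independence and spanning follow by induction on `d`, once one knows that the monogenics of degree
`d` not depending on `x₃` are the right multiples of `G_d^d`; this is Euler's relation.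

Under rotations about the third axis the components of the product of the conjugate of `G_d^n` with
`G_d^m` have weights `n - m` and `-(n + m + 1)`. For `n ≠ m` both are nonzero, and a function of
nonzero weight integrates to zero over the sphere.
-/

noncomputable section

namespace SphMon

open scoped Polynomial ComplexConjugate Pointwise

section Homogeneous

/-- Homogeneity of degree `d` of a map between vector spaces, for all scalars including `0`. -/
def HomogeneousOfDegree (𝕜 : Type*) {E V : Type*} [Monoid 𝕜] [SMul 𝕜 E] [SMul 𝕜 V] (d : ℕ)
    (f : E → V) : Prop :=
  ∀ (t : 𝕜) (x : E), f (t • x) = t ^ d • f x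

theorem HomogeneousOfDegree.eq_const_of_zero {𝕜 E V : Type*} [MonoidWithZero 𝕜] [Zero E]
    [SMulWithZero 𝕜 E] [MulAction 𝕜 V] {f : E → V} (hf : HomogeneousOfDegree 𝕜 0 f) (x : E) :
    f x = f 0 := by
  simpa using (hf 0 x).symm

variable {𝕜 E V : Type*} [NontriviallyNormedField 𝕜] [NormedAddCommGroup E] [NormedSpace 𝕜 E]
  [NormedAddCommGroup V] [NormedSpace 𝕜 V] {f : E → V} {d : ℕ}

theorem homogeneousOfDegree_fderiv (hf : HomogeneousOfDegree 𝕜 (d + 1) f)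
    (hf' : ContDiff 𝕜 1 f) : HomogeneousOfDegree 𝕜 d (fderiv 𝕜 f) := by
  intro t x
  have hne : Set.EqOn (fun s : 𝕜 => fderiv 𝕜 f (s • x))
      (fun s => s ^ d • fderiv 𝕜 f x) {0}ᶜ := by
    intro s hs
    have h : s • fderiv 𝕜 f (s • x) = s ^ (d + 1) • fderiv 𝕜 f x := by
      rw [← fderiv_comp_smul, ← fderiv_fun_const_smul (hf'.differentiable one_ne_zero x)]
      exact congrArg (fderiv 𝕜 · x) (funext fun y => hf s y)
    refine smul_right_injective _ (Set.mem_compl_singleton_iff.mp hs) ?_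
    simpa only [pow_succ', mul_smul] using h
  exact congrFun (Continuous.ext_on (dense_compl_singleton 0)
    ((hf'.continuous_fderiv one_ne_zero).comp (by fun_prop)) (by fun_prop) hne) t

theorem HomogeneousOfDegree.fderiv_apply_self (hf : HomogeneousOfDegree 𝕜 d f) {x : E}
    (hx : DifferentiableAt 𝕜 f x) : fderiv 𝕜 f x x = (d : 𝕜) • f x := by
  have hline : HasDerivAt (fun t : 𝕜 => t • x) x 1 := by
    simpa using (hasDerivAt_id (1 : 𝕜)).smul_const x
  have hchain : HasDerivAt (fun t : 𝕜 => f (t • x)) (fderiv 𝕜 f x x) 1 :=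
    HasFDerivAt.comp_hasDerivAt 1 (by simpa using hx.hasFDerivAt) hline
  have hpow : HasDerivAt (fun t : 𝕜 => t ^ d • f x) ((d : 𝕜) • f x) 1 := by
    simpa using (hasDerivAt_pow d (1 : 𝕜)).smul_const (f x)
  exact hchain.unique (by simpa only [hf _ x] using hpow)

theorem fderiv_fderiv_apply_comm [IsRCLikeNormedField 𝕜] (hf : ContDiff 𝕜 2 f) (x v w : E) :
    fderiv 𝕜 (fun y => fderiv 𝕜 f y v) x w = fderiv 𝕜 (fun y => fderiv 𝕜 f y w) x v := by
  have hdiff : DifferentiableAt 𝕜 (fderiv 𝕜 f) x :=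
    (hf.fderiv_right (m := 1) le_rfl).differentiable one_ne_zero x
  have hsymm : IsSymmSndFDerivAt 𝕜 f x := hf.contDiffAt.isSymmSndFDerivAt (by simp)
  rw [fderiv_clm_apply hdiff (differentiableAt_const v),
    fderiv_clm_apply hdiff (differentiableAt_const w)]
  simpa using hsymm w v

theorem fderiv_fderiv_apply_eq_zero [IsRCLikeNormedField 𝕜] (hf : ContDiff 𝕜 2 f) {w : E}
    (hw : ∀ x, fderiv 𝕜 f x w = 0) (v x : E) : fderiv 𝕜 (fun y => fderiv 𝕜 f y v) x w = 0 := by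
  rw [fderiv_fderiv_apply_comm hf, funext hw]
  simp

end Homogeneous

section HomogPoly

variable {d : ℕ} {f : E3 → Cl3}

theorem IsHomogPoly.contDiff {m : WithTop ℕ∞} (hf : IsHomogPoly d f) : ContDiff ℝ m f := by
  obtain ⟨c, hc⟩ := hf
  rw [funext hc]
  fun_prop

theorem IsHomogPoly.homogeneousOfDegree (hf : IsHomogPoly d f) : HomogeneousOfDegree ℝ d f := by
  obtain ⟨c, hc⟩ := hf
  intro t x
  rw [hc, hc, Finset.smul_sum]
  refine Finset.sum_congr rfl fun α hα => ?_
  rw [smul_smul, ← (Finset.mem_piAntidiag.1 hα).1, ← Finset.prod_pow_eq_pow_sum,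
    ← Finset.prod_mul_distrib]
  simp only [PiLp.smul_apply, smul_eq_mul, mul_pow]

theorem isHomogPoly_zero_const (a : Cl3) : IsHomogPoly 0 fun _ => a :=
  ⟨fun _ => a, fun x => by simp⟩

theorem IsHomogPoly.const_smul (hf : IsHomogPoly d f) (t : ℝ) : IsHomogPoly d (t • f) := by
  obtain ⟨c, hc⟩ := hf
  exact ⟨t • c, fun x => by simp [hc, Finset.smul_sum, smul_comm t]⟩

theorem IsHomogPoly.sum {ι : Type*} {s : Finset ι} {g : ι → E3 → Cl3}
    (hg : ∀ i ∈ s, IsHomogPoly d (g i)) : IsHomogPoly d (∑ i ∈ s, g i) := by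
  choose! c hc using hg
  refine ⟨∑ i ∈ s, c i, fun x => ?_⟩
  simp only [Finset.sum_apply, Finset.smul_sum]
  rw [Finset.sum_comm]
  exact Finset.sum_congr rfl fun i hi => hc i hi x

theorem IsHomogPoly.coord_smul (hf : IsHomogPoly d f) (j : Fin 3) :
    IsHomogPoly (d + 1) fun x => x j • f x := by
  obtain ⟨c, hc⟩ := hf
  refine ⟨fun β => if β j = 0 then 0 else c (β - Pi.single j 1), fun x => ?_⟩
  simp only [hc, Finset.smul_sum, smul_smul]
  refine Finset.sum_of_injOn (· + Pi.single j 1) (add_left_injective _).injOn ?_ ?_ ?_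
  · intro α hα
    simpa [Finset.sum_add_distrib] using hα
  · intro β hβ hβ'
    suffices h : β j = 0 by simp [h]
    by_contra h
    have hβj : Pi.single j 1 ≤ β := fun i => by
      obtain rfl | hij := eq_or_ne i j
      · simpa [Nat.one_le_iff_ne_zero] using h
      · simp [hij]
    refine hβ' ⟨β - Pi.single j 1, ?_, tsub_add_cancel_of_le hβj⟩
    have hsum : ∑ i, (β - Pi.single j 1 + Pi.single j 1 : Fin 3 → ℕ) i = d + 1 := by
      rw [tsub_add_cancel_of_le hβj]
      simpa using hβ
    simpa [Finset.sum_add_distrib] using hsum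
  · intro α _
    have hprod : ∏ i, x i ^ (Pi.single j 1 : Fin 3 → ℕ) i = x j := by
      rw [Finset.prod_eq_single j (by simp +contextual) (by simp)]
      simp
    simp [pow_add, Finset.prod_mul_distrib, hprod, mul_comm]

theorem sum_smul_fderiv_single {ι V : Type*} [Fintype ι] [DecidableEq ι] [NormedAddCommGroup V]
    [NormedSpace ℝ V] (f : EuclideanSpace ℝ ι → V) (x v : EuclideanSpace ℝ ι) :
    ∑ j, v j • fderiv ℝ f x (EuclideanSpace.single j 1) = fderiv ℝ f x v := by
  conv_rhs => rw [← (EuclideanSpace.basisFun ι ℝ).sum_repr v]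
  simp

theorem isHomogPoly_of_homogeneousOfDegree :
    ∀ {d : ℕ} {f : E3 → Cl3}, ContDiff ℝ (d : ℕ∞) f → HomogeneousOfDegree ℝ d f → IsHomogPoly d f
  | 0, f, _, hf => by
    rw [funext hf.eq_const_of_zero]
    exact isHomogPoly_zero_const (f 0)
  | d + 1, f, hf', hf => by
    have hpartial (j : Fin 3) :
        IsHomogPoly d fun x => fderiv ℝ f x (EuclideanSpace.single j 1) := by
      refine isHomogPoly_of_homogeneousOfDegree ?_ fun t x => ?_
      · exact (hf'.fderiv_right le_rfl).clm_apply contDiff_const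
      · rw [homogeneousOfDegree_fderiv hf (hf'.of_le (by simp)) t x]
        rfl
    have heuler : f = ((d + 1 : ℕ) : ℝ)⁻¹ • ∑ j, fun x : E3 =>
        x j • fderiv ℝ f x (EuclideanSpace.single j 1) := by
      funext x
      rw [Pi.smul_apply, Finset.sum_apply, sum_smul_fderiv_single, hf.fderiv_apply_self
        (hf'.differentiable (by simp) x), inv_smul_smul₀ (by positivity)]
    rw [heuler]
    exact (IsHomogPoly.sum fun j _ => (hpartial j).coord_smul j).const_smul _

end HomogPoly

section Dirac

open scoped ContDiff

variable {d : ℕ} {f g : E3 → Cl3} {x : E3}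

/-- Left multiplication by `a`, as a continuous real-linear map. -/
def mulLeftL (a : Cl3) : Cl3 →L[ℝ] Cl3 :=
  LinearMap.toContinuousLinearMap (LinearMap.mulLeft ℝ a)

theorem mulLeftL_apply (a b : Cl3) : mulLeftL a b = a * b := rfl

theorem mulRightL_apply (a b : Cl3) : mulRightL a b = b * a := rfl

theorem dirac_const (a : Cl3) : dirac (fun _ => a) x = 0 := by
  simp [dirac]

theorem dirac_sub (hf : DifferentiableAt ℝ f x) (hg : DifferentiableAt ℝ g x) :
    dirac (fun y => f y - g y) x = dirac f x - dirac g x := by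
  simp [dirac, fderiv_fun_sub hf hg, mul_sub, Finset.sum_sub_distrib]

theorem dirac_mul_const (hf : DifferentiableAt ℝ f x) (a : Cl3) :
    dirac (fun y => f y * a) x = dirac f x * a := by
  have h : HasFDerivAt (fun y => f y * a) ((mulRightL a).comp (fderiv ℝ f x)) x :=
    (mulRightL a).hasFDerivAt.comp x hf.hasFDerivAt
  simp [dirac, h.fderiv, mulRightL_apply, Finset.sum_mul, mul_assoc]

theorem dirac_fderiv_apply (hf : ContDiff ℝ 2 f) (v : E3) :
    dirac (fun y => fderiv ℝ f y v) x = fderiv ℝ (dirac f) x v := by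
  have hpartial (j : Fin 3) : HasFDerivAt (fun y => e j * fderiv ℝ f y (EuclideanSpace.single j 1))
      ((mulLeftL (e j)).comp (fderiv ℝ (fun y => fderiv ℝ f y (EuclideanSpace.single j 1)) x)) x :=
    (mulLeftL (e j)).hasFDerivAt.comp x
      (((hf.fderiv_right (m := 1) le_rfl).clm_apply contDiff_const).differentiable
        one_ne_zero x).hasFDerivAt
  have hdirac : HasFDerivAt (dirac f) _ x := HasFDerivAt.fun_sum fun j _ => hpartial j
  rw [hdirac.fderiv]
  simp [dirac, mulLeftL_apply, fderiv_fderiv_apply_comm hf x v]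

theorem mem_monogenics_iff :
    f ∈ monogenics d ↔ ContDiff ℝ ω f ∧ HomogeneousOfDegree ℝ d f ∧ ∀ x, dirac f x = 0 :=
  ⟨fun hf => ⟨hf.1.contDiff, hf.1.homogeneousOfDegree, hf.2.2⟩, fun ⟨hsmooth, hhom, hdirac⟩ =>
    ⟨isHomogPoly_of_homogeneousOfDegree (hsmooth.of_le le_top) hhom, hsmooth.of_le le_top, hdirac⟩⟩

theorem fderiv_apply_mem_monogenics (hf : f ∈ monogenics (d + 1)) (v : E3) :
    (fun x => fderiv ℝ f x v) ∈ monogenics d := by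
  obtain ⟨hsmooth, hhom, hdirac⟩ := mem_monogenics_iff.1 hf
  refine mem_monogenics_iff.2 ⟨?_, fun t x => ?_, fun x => ?_⟩
  · exact (hsmooth.fderiv_right le_top).clm_apply contDiff_const
  · simp only [homogeneousOfDegree_fderiv hhom (hsmooth.of_le le_top) t x]
    rfl
  · rw [dirac_fderiv_apply (hsmooth.of_le le_top), funext hdirac]
    simp

end Dirac

section ComplexSubalgebra

theorem e_one_mul_e_zero : e 1 * e 0 = -(e 0 * e 1) := e_anticomm (by decide)

theorem e_zero_mul_e_two : e 0 * e 2 = -(e 2 * e 0) := e_anticomm (by decide)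

theorem e_one_mul_e_two : e 1 * e 2 = -(e 2 * e 1) := e_anticomm (by decide)

theorem e_zero_mul_e_one_sq : (e 0 * e 1) * (e 0 * e 1) = -1 := by
  rw [mul_assoc, ← mul_assoc (e 1), e_one_mul_e_zero, neg_mul, mul_assoc (e 0) (e 1), e_sq,
    mul_neg, mul_neg, mul_neg, mul_one, neg_neg, e_sq]

/-- The embedding `ℂ → ℝ₃` sending `i` to `e₁₂`. -/
def cplx : ℂ →ₐ[ℝ] Cl3 := Complex.lift ⟨e 0 * e 1, e_zero_mul_e_one_sq⟩

theorem cplx_apply (w : ℂ) : cplx w = algebraMap ℝ Cl3 w.re + w.im • (e 0 * e 1) := by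
  rw [cplx, Complex.lift_apply, Complex.liftAux_apply]

theorem cplx_I : cplx Complex.I = e 0 * e 1 := by
  simp [cplx_apply]

theorem cplx_mul_e_zero (w : ℂ) : cplx w * e 0 = e 0 * cplx (starRingEnd ℂ w) := by
  simp only [cplx_apply, add_mul, mul_add, smul_mul_assoc, mul_smul_comm, Complex.conj_re,
    Complex.conj_im, mul_assoc, e_one_mul_e_zero, Algebra.commutes, mul_neg, smul_neg, neg_smul]

theorem cplx_mul_e_two (w : ℂ) : cplx w * e 2 = e 2 * cplx w := by
  simp only [cplx_apply, add_mul, mul_add, smul_mul_assoc, mul_smul_comm, mul_assoc,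
    e_one_mul_e_two, Algebra.commutes, mul_neg, ← mul_assoc (e 0), e_zero_mul_e_two, neg_mul,
    neg_neg]

theorem star_cplx (w : ℂ) : star (cplx w) = cplx (starRingEnd ℂ w) := by
  rw [cplx_apply, cplx_apply, star_add, CliffordAlgebra.star_algebraMap, CliffordAlgebra.star_smul,
    star_mul, star_e, star_e, neg_mul_neg, e_one_mul_e_zero]
  simp

theorem e_one_eq : e 1 = -(e 0 * cplx Complex.I) := by
  rw [cplx_I, ← mul_assoc, e_sq, neg_one_mul, neg_neg]

/-- The embedding `cplx` as a continuous real-linear map. -/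
def cplxL : ℂ →L[ℝ] Cl3 := LinearMap.toContinuousLinearMap cplx.toLinearMap

section

variable {g h : E3 → ℂ} {x : E3}

theorem contDiff_mul_cplx_sub {m : WithTop ℕ∞} (hg : ContDiff ℝ m g) (hh : ContDiff ℝ m h)
    (a b : Cl3) : ContDiff ℝ m fun y => a * cplx (g y) - b * cplx (h y) :=
  (((mulLeftL a).comp cplxL).contDiff.comp hg).sub (((mulLeftL b).comp cplxL).contDiff.comp hh)

theorem fderiv_cplx (hg : DifferentiableAt ℝ g x) (v : E3) :
    fderiv ℝ (fun y => cplx (g y)) x v = cplx (fderiv ℝ g x v) :=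
  congrArg (· v) (cplxL.hasFDerivAt.comp x hg.hasFDerivAt).fderiv

theorem fderiv_mul_cplx_sub (hg : DifferentiableAt ℝ g x) (hh : DifferentiableAt ℝ h x)
    (a b : Cl3) (v : E3) : fderiv ℝ (fun y => a * cplx (g y) - b * cplx (h y)) x v =
      a * cplx (fderiv ℝ g x v) - b * cplx (fderiv ℝ h x v) :=
  congrArg (· v) ((((mulLeftL a).comp cplxL).hasFDerivAt.comp x hg.hasFDerivAt).sub
    (((mulLeftL b).comp cplxL).hasFDerivAt.comp x hh.hasFDerivAt)).fderiv

theorem dirac_eq (f : E3 → Cl3) (x : E3) :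
    dirac f x = e 0 * (fderiv ℝ f x (EuclideanSpace.single 0 1) -
        cplx Complex.I * fderiv ℝ f x (EuclideanSpace.single 1 1)) +
      e 2 * fderiv ℝ f x (EuclideanSpace.single 2 1) := by
  rw [dirac, Fin.sum_univ_three, e_one_eq, neg_mul, mul_assoc, mul_sub, sub_eq_add_neg]

theorem dirac_cplx (hg : DifferentiableAt ℝ g x) :
    dirac (fun y => cplx (g y)) x =
      e 0 * cplx (fderiv ℝ g x (EuclideanSpace.single 0 1) -
          Complex.I * fderiv ℝ g x (EuclideanSpace.single 1 1)) +
        e 2 * cplx (fderiv ℝ g x (EuclideanSpace.single 2 1)) := by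
  simp only [dirac_eq, fderiv_cplx hg, map_sub, map_mul]

theorem dirac_mul_cplx_sub (hg : DifferentiableAt ℝ g x) (hh : DifferentiableAt ℝ h x) :
    dirac (fun y => e 2 * cplx (g y) - e 0 * cplx (h y)) x =
      e 0 * e 2 * cplx (fderiv ℝ g x (EuclideanSpace.single 0 1) -
          Complex.I * fderiv ℝ g x (EuclideanSpace.single 1 1) +
          fderiv ℝ h x (EuclideanSpace.single 2 1)) +
        cplx (fderiv ℝ h x (EuclideanSpace.single 0 1) +
          Complex.I * fderiv ℝ h x (EuclideanSpace.single 1 1) -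
          fderiv ℝ g x (EuclideanSpace.single 2 1)) := by
  have hI : cplx Complex.I * e 0 = -(e 0 * cplx Complex.I) := by simp [cplx_mul_e_zero]
  have h20 : e 2 * e 0 = -(e 0 * e 2) := e_anticomm (by decide)
  simp only [dirac_eq, fderiv_mul_cplx_sub hg hh, map_sub, map_add, map_mul, mul_sub, mul_add]
  simp only [← mul_assoc, cplx_mul_e_two, hI, mul_neg, h20, e_sq]
  simp only [neg_mul, one_mul, mul_assoc]
  abel

end

end ComplexSubalgebra

section PowerCoefficients

open Polynomial

section Deriv

variable {𝕜 E A : Type*} [NontriviallyNormedField 𝕜] [CompleteSpace 𝕜] [NormedAddCommGroup E]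
  [NormedSpace 𝕜 E] [FiniteDimensional 𝕜 E] [NormedCommRing A] [NormedAlgebra 𝕜 A]

theorem contDiff_coeff_pow {m : WithTop ℕ∞} (q : E →ₗ[𝕜] A[X]) (d k : ℕ) :
    ContDiff 𝕜 m fun y => (q y ^ d).coeff k := by
  induction d generalizing k with
  | zero => simpa only [pow_zero] using contDiff_const
  | succ d ih =>
    simp only [pow_succ, coeff_mul]
    exact ContDiff.sum fun i _ => (ih i.1).mul
      (LinearMap.toContinuousLinearMap (((lcoeff A i.2).restrictScalars 𝕜).comp q)).contDiff

theorem fderiv_coeff_pow (q : E →ₗ[𝕜] A[X]) (d k : ℕ) (x v : E) :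
    fderiv 𝕜 (fun y => (q y ^ d).coeff k) x v = (d * q x ^ (d - 1) * q v).coeff k := by
  induction d generalizing k with
  | zero => simp
  | succ d ih =>
    have hlin (j : ℕ) : HasFDerivAt (fun y => (q y).coeff j)
        (LinearMap.toContinuousLinearMap (((lcoeff A j).restrictScalars 𝕜).comp q)) x :=
      (LinearMap.toContinuousLinearMap
        (((lcoeff A j).restrictScalars 𝕜).comp q)).hasFDerivAt
    have hpow (i : ℕ) := ((contDiff_coeff_pow (m := 1) q d i).differentiable
      one_ne_zero x).hasFDerivAt
    have hrec : (((d + 1 : ℕ) : A[X]) * q x ^ (d + 1 - 1) * q v) =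
        q x ^ d * q v + (d * q x ^ (d - 1) * q v) * q x := by
      rcases d with - | d
      · simp
      · push_cast [Nat.add_sub_cancel]
        ring
    rw [hrec, coeff_add, coeff_mul, coeff_mul, ← Finset.sum_add_distrib]
    simp only [pow_succ, coeff_mul (q _ ^ d) (q _)]
    rw [(HasFDerivAt.fun_sum fun i _ => (hpow i.1).mul (hlin i.2)).fderiv]
    simp [ih, mul_comm]

end Deriv

theorem coeff_quadratic_pow {R : Type*} [CommRing R] [IsDomain R] (a b c : R) (d n : ℕ) :
    ((C a * X ^ 2 + C b * X + C c) ^ d).coeff (d + n) =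
      a ^ n * ((X ^ 2 + C b * X + C (a * c)) ^ d).coeff (d + n) := by
  rcases eq_or_ne a 0 with rfl | ha
  · rcases Nat.eq_zero_or_pos n with rfl | hn
    · have hleft : ((C b * X + C c) ^ d).coeff d = b ^ d := by
        simpa using coeff_pow_of_natDegree_le (m := d) (natDegree_linear_le (a := b) (b := c))
      have hright : ((X ^ 2 + C b * X) ^ d).coeff d = b ^ d := by
        rw [sq, ← add_mul, mul_pow, coeff_mul_X_pow', if_pos le_rfl, Nat.sub_self,
          coeff_X_add_C_pow, Nat.sub_zero, Nat.choose_zero_right, Nat.cast_one, mul_one]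
      simpa using hleft.trans hright.symm
    · rw [zero_pow hn.ne', zero_mul]
      refine coeff_eq_zero_of_natDegree_lt ((natDegree_pow_le_of_le (m := 1) d ?_).trans_lt ?_)
      · simpa using natDegree_linear_le (a := b) (b := c)
      · omega
  · have hcomp : C (a ^ d) * (C a * X ^ 2 + C b * X + C c) ^ d =
        ((X ^ 2 + C b * X + C (a * c)) ^ d).comp (C a * X) := by
      simp only [pow_comp, add_comp, mul_comp, X_comp, C_comp, map_pow, ← mul_pow, map_mul]
      ring
    have hcoeff := congrArg (coeff · (d + n)) hcomp
    simp only [coeff_C_mul, comp_C_mul_X_coeff, pow_add] at hcoeff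
    refine mul_left_cancel₀ (pow_ne_zero d ha) ?_
    rw [hcoeff]
    ring

end PowerCoefficients

section SolidHarmonics

open Polynomial

/-- The complex coordinate `x₁ + i x₂`. -/
def zeta (x : E3) : ℂ := ⟨x 0, x 1⟩

theorem zeta_smul (t : ℝ) (x : E3) : zeta (t • x) = t * zeta x := by
  simp [zeta, Complex.ext_iff]

theorem zeta_eq_zero_iff {x : E3} : zeta x = 0 ↔ x 0 = 0 ∧ x 1 = 0 := by
  simp [zeta, Complex.ext_iff]

/-- The generating polynomial `ζ̄ X² + x₃ X - ζ / 4` of the solid harmonics, with `ζ = x₁ + i x₂`;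
its coefficient vector is isotropic, so that its powers are harmonic in `x`. -/
def genPoly : E3 →ₗ[ℝ] ℂ[X] where
  toFun x := C (conj (zeta x)) * X ^ 2 + C (x 2 : ℂ) * X - C (zeta x / 4)
  map_add' x y := by
    have h : zeta (x + y) = zeta x + zeta y := by simp [zeta, Complex.ext_iff]
    simp only [h, PiLp.add_apply, map_add, Complex.ofReal_add, add_div]
    ring
  map_smul' t x := by
    simp only [zeta_smul, PiLp.smul_apply, smul_eq_mul, map_mul, Complex.conj_ofReal,
      Complex.ofReal_mul, mul_div_assoc, RingHom.id_apply, smul_sub, smul_add, ← smul_mul_assoc,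
      smul_C, Complex.real_smul]

theorem genPoly_apply (x : E3) :
    genPoly x = C (conj (zeta x)) * X ^ 2 + C (x 2 : ℂ) * X - C (zeta x / 4) := rfl

theorem genPoly_single_zero : genPoly (EuclideanSpace.single 0 1) = X ^ 2 - C (1 / 4) := by
  have h : zeta (EuclideanSpace.single 0 1) = 1 := by simp [zeta, Complex.ext_iff]
  simp [genPoly_apply, h]

theorem genPoly_single_one :
    genPoly (EuclideanSpace.single 1 1) = -(C Complex.I * (X ^ 2 + C (1 / 4))) := by
  have h : zeta (EuclideanSpace.single 1 1) = Complex.I := by simp [zeta, Complex.ext_iff]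
  rw [genPoly_apply, h, mul_add, ← C_mul, mul_one_div, Complex.conj_I]
  simp [sub_eq_add_neg, add_comm]

theorem C_I_mul_C_I : (C Complex.I * C Complex.I : ℂ[X]) = -1 := by
  simp [← C_mul]

theorem genPoly_single_two : genPoly (EuclideanSpace.single 2 1) = X := by
  simp [genPoly_apply, zeta_eq_zero_iff.2]

/-- The solid harmonic of degree `d` that picks up the factor `e ^ (-i n θ)` under rotations by `θ`
about the third axis. -/
def solid (n d : ℕ) (x : E3) : ℂ := (genPoly x ^ d).coeff (d + n) / d.factorial

theorem contDiff_solid {m : WithTop ℕ∞} (n d : ℕ) : ContDiff ℝ m (solid n d) :=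
  (contDiff_coeff_pow genPoly d (d + n)).div_const _

theorem differentiableAt_solid (n d : ℕ) (x : E3) : DifferentiableAt ℝ (solid n d) x :=
  (contDiff_solid n d).differentiable one_ne_zero x

theorem homogeneousOfDegree_solid (n d : ℕ) : HomogeneousOfDegree ℝ d (solid n d) := by
  intro t x
  rw [solid, solid, map_smul, _root_.smul_pow, coeff_smul, smul_div_assoc]

theorem fderiv_solid_succ (n d : ℕ) (x v : E3) :
    fderiv ℝ (solid n (d + 1)) x v =
      (genPoly x ^ d * genPoly v).coeff (d + 1 + n) / d.factorial := by
  have h : solid n (d + 1) = fun y => ((d + 1).factorial : ℂ)⁻¹ •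
      (genPoly y ^ (d + 1)).coeff (d + 1 + n) := by
    funext y
    rw [solid, div_eq_inv_mul, smul_eq_mul]
  rw [h, fderiv_fun_const_smul ((contDiff_coeff_pow (m := 1) genPoly _ _).differentiable
    one_ne_zero x), smul_apply, fderiv_coeff_pow, Nat.add_sub_cancel, mul_assoc,
    coeff_natCast_mul, smul_eq_mul, Nat.factorial_succ]
  have hd : (d : ℂ) + 1 ≠ 0 := by exact_mod_cast d.succ_ne_zero
  push_cast
  field_simp

theorem fderiv_solid_succ_single_two (n d : ℕ) (x : E3) :
    fderiv ℝ (solid n (d + 1)) x (EuclideanSpace.single 2 1) = solid n d x := by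
  rw [fderiv_solid_succ, genPoly_single_two, add_right_comm, coeff_mul_X, solid]

theorem fderiv_solid_succ_single_zero_sub (n d : ℕ) (x : E3) :
    fderiv ℝ (solid n (d + 1)) x (EuclideanSpace.single 0 1) -
      Complex.I * fderiv ℝ (solid n (d + 1)) x (EuclideanSpace.single 1 1) =
        -(1 / 2) * solid (n + 1) d x := by
  have hvalue : genPoly (EuclideanSpace.single 0 1) -
      C Complex.I * genPoly (EuclideanSpace.single 1 1) = C (-(1 / 2)) := by
    have hC : (C (-(1 / 2)) : ℂ[X]) = -C (1 / 4) - C (1 / 4) := by rw [← C_neg, ← C_sub]; norm_num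
    rw [genPoly_single_zero, genPoly_single_one, hC]
    linear_combination (X ^ 2 + C (1 / 4)) * C_I_mul_C_I
  simp only [fderiv_solid_succ, ← mul_div_assoc, ← sub_div, ← coeff_C_mul, ← coeff_sub,
    mul_left_comm (C Complex.I), ← mul_sub, hvalue, solid]
  rw [mul_comm, add_assoc, add_comm 1]

theorem fderiv_solid_succ_single_zero_add (n d : ℕ) (x : E3) :
    fderiv ℝ (solid (n + 1) (d + 1)) x (EuclideanSpace.single 0 1) +
      Complex.I * fderiv ℝ (solid (n + 1) (d + 1)) x (EuclideanSpace.single 1 1) =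
        2 * solid n d x := by
  have hvalue : genPoly (EuclideanSpace.single 0 1) +
      C Complex.I * genPoly (EuclideanSpace.single 1 1) = C 2 * X ^ 2 := by
    rw [genPoly_single_zero, genPoly_single_one, C_ofNat]
    linear_combination -(X ^ 2 + C (1 / 4)) * C_I_mul_C_I
  have hdegree : d + 1 + (n + 1) = d + n + 2 := by ring
  simp only [fderiv_solid_succ, ← mul_div_assoc, ← add_div, ← coeff_C_mul, ← coeff_add,
    mul_left_comm (C Complex.I), ← mul_add, hvalue, solid]
  rw [mul_left_comm, hdegree, coeff_C_mul, coeff_mul_X_pow, coeff_C_mul]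

theorem natDegree_genPoly_le (x : E3) : (genPoly x).natDegree ≤ 2 := by
  rw [genPoly_apply, sub_eq_add_neg, ← C_neg]
  exact natDegree_quadratic_le

theorem solid_eq_zero_of_lt {n d : ℕ} (h : d < n) (x : E3) : solid n d x = 0 := by
  rw [solid, coeff_eq_zero_of_natDegree_lt, zero_div]
  have := natDegree_pow_le_of_le d (natDegree_genPoly_le x)
  omega

theorem solid_self (d : ℕ) (x : E3) : solid d d x = conj (zeta x) ^ d / d.factorial := by
  rw [solid, ← mul_two, coeff_pow_of_natDegree_le (natDegree_genPoly_le x)]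
  simp [genPoly_apply]

end SolidHarmonics

section SolidMonogenics

/-- The Clifford gradient of the solid harmonic `solid n (d + 1)`: a homogeneous left monogenic
polynomial of degree `d`, proportional to `monogenicF (d + 1) n`. -/
def solidMonogenic (n d : ℕ) (x : E3) : Cl3 :=
  e 2 * cplx (solid n d x) - e 0 * cplx (1 / 2 * solid (n + 1) d x)

theorem dirac_cplx_solid (n d : ℕ) (x : E3) :
    dirac (fun y => cplx (solid n (d + 1) y)) x = solidMonogenic n d x := by
  rw [dirac_cplx (differentiableAt_solid n (d + 1) x), fderiv_solid_succ_single_zero_sub,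
    fderiv_solid_succ_single_two, solidMonogenic, neg_mul, map_neg, mul_neg, neg_add_eq_sub]

theorem contDiff_solidMonogenic (n d : ℕ) {m : WithTop ℕ∞} : ContDiff ℝ m (solidMonogenic n d) :=
  contDiff_mul_cplx_sub (contDiff_solid n d) (contDiff_const.mul (contDiff_solid (n + 1) d)) _ _

theorem differentiableAt_solidMonogenic (n d : ℕ) (x : E3) :
    DifferentiableAt ℝ (solidMonogenic n d) x :=
  (contDiff_solidMonogenic n d).differentiable one_ne_zero x

theorem homogeneousOfDegree_solidMonogenic (n d : ℕ) :
    HomogeneousOfDegree ℝ d (solidMonogenic n d) := by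
  intro t x
  simp only [solidMonogenic, homogeneousOfDegree_solid _ d t x, mul_smul_comm, map_smul, smul_sub]

theorem fderiv_solidMonogenic_succ_single_two (n d : ℕ) (x : E3) :
    fderiv ℝ (solidMonogenic n (d + 1)) x (EuclideanSpace.single 2 1) = solidMonogenic n d x := by
  unfold solidMonogenic
  rw [fderiv_mul_cplx_sub (differentiableAt_solid n (d + 1) x)
      ((differentiableAt_solid (n + 1) (d + 1) x).const_mul _),
    fderiv_const_mul (differentiableAt_solid (n + 1) (d + 1) x), smul_apply,
    fderiv_solid_succ_single_two, fderiv_solid_succ_single_two, smul_eq_mul]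

theorem solidMonogenic_zero (n : ℕ) (x : E3) : solidMonogenic n 0 x = solidMonogenic n 0 0 :=
  (homogeneousOfDegree_solidMonogenic n 0).eq_const_of_zero x

theorem dirac_solidMonogenic (n : ℕ) : ∀ (d : ℕ) (x : E3), dirac (solidMonogenic n d) x = 0
  | 0, x => by rw [funext (solidMonogenic_zero n), dirac_const]
  | d + 1, x => by
    have hhigh := differentiableAt_solid (n + 1) (d + 1) x
    unfold solidMonogenic
    rw [dirac_mul_cplx_sub (differentiableAt_solid n (d + 1) x) (hhigh.const_mul _),
      fderiv_const_mul hhigh]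
    simp only [smul_apply, smul_eq_mul, mul_left_comm Complex.I, ← mul_add,
      fderiv_solid_succ_single_zero_sub, fderiv_solid_succ_single_zero_add,
      fderiv_solid_succ_single_two]
    ring_nf
    simp

theorem solidMonogenic_mem_monogenics (n d : ℕ) : solidMonogenic n d ∈ monogenics d :=
  mem_monogenics_iff.2 ⟨contDiff_solidMonogenic n d, homogeneousOfDegree_solidMonogenic n d,
    dirac_solidMonogenic n d⟩

theorem solidMonogenic_succ_self (d : ℕ) : solidMonogenic (d + 1) d = 0 := by
  funext x
  simp [solidMonogenic, solid_eq_zero_of_lt d.lt_add_one,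
    solid_eq_zero_of_lt (d.lt_add_one.trans (d + 1).lt_add_one)]

theorem solidMonogenic_self (d : ℕ) (x : E3) :
    solidMonogenic d d x = e 2 * cplx (conj (zeta x) ^ d / d.factorial) := by
  simp [solidMonogenic, solid_eq_zero_of_lt d.lt_add_one, solid_self]

end SolidMonogenics

section SolidMonogenicBasis

variable {d : ℕ} {f : E3 → Cl3}

theorem hasFDerivAt_sum_mul {ι : Type*} {s : Finset ι} {g : ι → E3 → Cl3} {x : E3}
    (hg : ∀ n ∈ s, DifferentiableAt ℝ (g n) x) (a : ι → Cl3) :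
    HasFDerivAt (fun y => ∑ n ∈ s, g n y * a n)
      (∑ n ∈ s, (mulRightL (a n)).comp (fderiv ℝ (g n) x)) x :=
  HasFDerivAt.fun_sum fun n hn => (mulRightL (a n)).hasFDerivAt.comp x (hg n hn).hasFDerivAt

theorem fderiv_sum_solidMonogenic_mul_single_two (d : ℕ) (a : ℕ → Cl3) (x : E3) :
    fderiv ℝ (fun y => ∑ n ∈ Finset.range (d + 2), solidMonogenic n (d + 1) y * a n) x
        (EuclideanSpace.single 2 1) =
      ∑ n ∈ Finset.range (d + 1), solidMonogenic n d x * a n := by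
  rw [(hasFDerivAt_sum_mul (fun n _ => differentiableAt_solidMonogenic n (d + 1) x) a).fderiv,
    sum_apply]
  simp only [ContinuousLinearMap.comp_apply, mulRightL_apply, fderiv_solidMonogenic_succ_single_two]
  rw [Finset.sum_range_succ, solidMonogenic_succ_self, Pi.zero_apply, zero_mul, add_zero]

theorem eq_zero_of_solidMonogenic_self_mul_eq_zero {a : Cl3}
    (h : ∀ x, solidMonogenic d d x * a = 0) : a = 0 := by
  have hzeta : zeta (EuclideanSpace.single 0 1) = 1 := by simp [zeta, Complex.ext_iff]
  have hinv : cplx d.factorial * -(e 2) * solidMonogenic d d (EuclideanSpace.single 0 1) = 1 := by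
    rw [solidMonogenic_self, hzeta, mul_assoc, neg_mul, ← mul_assoc (e 2), e_sq, neg_mul, one_mul,
      neg_neg, ← map_mul, map_one, one_pow,
      mul_one_div_cancel (Nat.cast_ne_zero.2 d.factorial_ne_zero), map_one]
  rw [← one_mul a, ← hinv, mul_assoc, h, mul_zero]

theorem eq_zero_of_sum_solidMonogenic_mul_eq_zero {a : ℕ → Cl3}
    (h : ∀ x, ∑ n ∈ Finset.range (d + 1), solidMonogenic n d x * a n = 0) :
    ∀ n ∈ Finset.range (d + 1), a n = 0 := by
  induction d with
  | zero =>
    simpa using eq_zero_of_solidMonogenic_self_mul_eq_zero (by simpa using h)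
  | succ d ih =>
    have hlow : ∀ n ∈ Finset.range (d + 1), a n = 0 := ih fun x => by
      rw [← fderiv_sum_solidMonogenic_mul_single_two, funext h]
      simp
    have htop : a (d + 1) = 0 := eq_zero_of_solidMonogenic_self_mul_eq_zero fun x => by
      have hx := h x
      rwa [Finset.sum_range_succ, Finset.sum_eq_zero fun n hn => by rw [hlow n hn, mul_zero],
        zero_add] at hx
    simpa [Finset.range_add_one (n := d + 1), htop] using hlow

/-- Without dependence on `x₃`, the equation `∂ₓ f = 0` reads `∂₂ f = -e₁₂ ∂₁ f`, so that Euler's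
relation becomes `d f = ζ̄ ∂₁ f`. -/
theorem smul_eq_cplx_conj_zeta_mul_fderiv (hf : f ∈ monogenics d)
    (h2 : ∀ x, fderiv ℝ f x (EuclideanSpace.single 2 1) = 0) (x : E3) :
    (d : ℝ) • f x = cplx (conj (zeta x)) * fderiv ℝ f x (EuclideanSpace.single 0 1) := by
  obtain ⟨hsmooth, hhom, hdirac⟩ := mem_monogenics_iff.1 hf
  have hCR : fderiv ℝ f x (EuclideanSpace.single 0 1) =
      e 0 * e 1 * fderiv ℝ f x (EuclideanSpace.single 1 1) := by
    have hx := congrArg (-e 0 * ·) (hdirac x)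
    simp only [dirac_eq, h2, mul_zero, add_zero, ← mul_assoc, neg_mul, e_sq, neg_neg,
      one_mul, cplx_I] at hx
    exact sub_eq_zero.1 hx
  rw [← hhom.fderiv_apply_self (hsmooth.differentiable (by simp) x), ← sum_smul_fderiv_single,
    Fin.sum_univ_three, h2, hCR, cplx_apply, add_mul, ← Algebra.smul_def, smul_mul_assoc,
    ← mul_assoc, e_zero_mul_e_one_sq]
  simp [zeta]

theorem exists_eq_solidMonogenic_self_mul : ∀ {d : ℕ} {f : E3 → Cl3}, f ∈ monogenics d →
    (∀ x, fderiv ℝ f x (EuclideanSpace.single 2 1) = 0) →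
      ∃ a, ∀ x, f x = solidMonogenic d d x * a
  | 0, f, hf, _ => by
    refine ⟨-(e 2 * f 0), fun x => ?_⟩
    rw [(mem_monogenics_iff.1 hf).2.1.eq_const_of_zero, solidMonogenic_self]
    simp [← mul_assoc, e_sq]
  | d + 1, f, hf, h2 => by
    obtain ⟨a, ha⟩ := exists_eq_solidMonogenic_self_mul
      (fderiv_apply_mem_monogenics hf (EuclideanSpace.single 0 1))
      (fderiv_fderiv_apply_eq_zero ((mem_monogenics_iff.1 hf).1.of_le le_top) h2 _)
    have hd : ((d + 1 : ℕ) : ℝ) ≠ 0 := Nat.cast_ne_zero.2 d.succ_ne_zero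
    refine ⟨a, fun x => smul_right_injective Cl3 hd ?_⟩
    have hscale : ((d + 1 : ℕ) : ℝ) • (conj (zeta x) ^ (d + 1) / (d + 1).factorial : ℂ) =
        conj (zeta x) * (conj (zeta x) ^ d / d.factorial) := by
      rw [Nat.factorial_succ, Complex.real_smul]
      have hd : (d : ℂ) + 1 ≠ 0 := by exact_mod_cast d.succ_ne_zero
      push_cast
      field_simp
      ring
    beta_reduce
    rw [smul_eq_cplx_conj_zeta_mul_fderiv hf h2, ha, ← smul_mul_assoc, ← mul_assoc,
      solidMonogenic_self, solidMonogenic_self, ← mul_smul_comm, ← map_smul, hscale, map_mul,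
      ← mul_assoc, ← mul_assoc, cplx_mul_e_two]

theorem sum_solidMonogenic_mul_mem_monogenics (d : ℕ) (a : ℕ → Cl3) :
    (fun x => ∑ n ∈ Finset.range (d + 1), solidMonogenic n d x * a n) ∈ monogenics d := by
  have h : (fun x => ∑ n ∈ Finset.range (d + 1), solidMonogenic n d x * a n) =
      ∑ n ∈ Finset.range (d + 1), MulOpposite.op (a n) • solidMonogenic n d := by
    funext x
    simp
  rw [h]
  exact Submodule.sum_mem _ fun n _ => Submodule.smul_mem _ _ (solidMonogenic_mem_monogenics n d)

theorem exists_eq_sum_solidMonogenic_mul : ∀ {d : ℕ} {f : E3 → Cl3}, f ∈ monogenics d →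
    ∃ a : ℕ → Cl3, ∀ x, f x = ∑ n ∈ Finset.range (d + 1), solidMonogenic n d x * a n
  | 0, f, hf => by
    have hconst : f = fun _ => f 0 := funext (mem_monogenics_iff.1 hf).2.1.eq_const_of_zero
    obtain ⟨a, ha⟩ := exists_eq_solidMonogenic_self_mul hf (by rw [hconst]; simp)
    exact ⟨fun _ => a, by simpa using ha⟩
  | d + 1, f, hf => by
    obtain ⟨a, ha⟩ := exists_eq_sum_solidMonogenic_mul
      (fderiv_apply_mem_monogenics hf (EuclideanSpace.single 2 1))
    have hsum := sum_solidMonogenic_mul_mem_monogenics (d + 1) a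
    have hdiff {g : E3 → Cl3} (hg : g ∈ monogenics (d + 1)) : Differentiable ℝ g :=
      hg.2.1.differentiable one_ne_zero
    obtain ⟨b, hb⟩ := exists_eq_solidMonogenic_self_mul (Submodule.sub_mem _ hf hsum) fun x => by
      rw [fderiv_sub (hdiff hf x) (hdiff hsum x), sub_apply, ha,
        fderiv_sum_solidMonogenic_mul_single_two, sub_self]
    refine ⟨a + Pi.single (d + 1) b, fun x => ?_⟩
    have hx := hb x
    rw [Pi.sub_apply, sub_eq_iff_eq_add'] at hx
    simp [hx, mul_add, Finset.sum_add_distrib, Pi.single_apply]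

/-- The solid monogenics `solidMonogenic 0 d, …, solidMonogenic d d` as elements of the right module
`monogenics d`, for use as a basis of it. -/
def solidMonogenicFamily (d : ℕ) (n : Fin (d + 1)) : monogenics d :=
  ⟨solidMonogenic n d, solidMonogenic_mem_monogenics n d⟩

theorem linearIndependent_solidMonogenicFamily (d : ℕ) :
    LinearIndependent Cl3ᵐᵒᵖ (solidMonogenicFamily d) := by
  rw [Fintype.linearIndependent_iff]
  intro c hc n
  have hextend (m : Fin (d + 1)) : Function.extend Fin.val (MulOpposite.unop ∘ c) 0 m =
      (c m).unop := Fin.val_injective.extend_apply _ _ _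
  have hzero := eq_zero_of_sum_solidMonogenic_mul_eq_zero (d := d)
    (a := Function.extend Fin.val (MulOpposite.unop ∘ c) 0) (fun x => by
      rw [Finset.sum_range]
      simpa [hextend, solidMonogenicFamily] using congrFun (congrArg Subtype.val hc) x)
      n (Finset.mem_range.2 n.2)
  simpa [hextend] using hzero

theorem top_le_span_solidMonogenicFamily (d : ℕ) :
    ⊤ ≤ Submodule.span Cl3ᵐᵒᵖ (Set.range (solidMonogenicFamily d)) := by
  rintro ⟨f, hf⟩ -
  obtain ⟨a, ha⟩ := exists_eq_sum_solidMonogenic_mul hf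
  have h : (⟨f, hf⟩ : monogenics d) =
      ∑ n : Fin (d + 1), MulOpposite.op (a n) • solidMonogenicFamily d n := by
    refine Subtype.ext (funext fun x => ?_)
    simp [ha, Finset.sum_range, solidMonogenicFamily]
  rw [h]
  exact Submodule.sum_mem _ fun n _ => Submodule.smul_mem _ _ (Submodule.subset_span ⟨n, rfl⟩)

/-- The basis of the right `ℝ₃`-module `monogenics d` formed by the solid monogenics. -/
def solidMonogenicBasis (d : ℕ) : Module.Basis (Fin (d + 1)) Cl3ᵐᵒᵖ (monogenics d) :=
  Module.Basis.mk (linearIndependent_solidMonogenicFamily d) (top_le_span_solidMonogenicFamily d)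

theorem coe_solidMonogenicBasis_apply (d : ℕ) (n : Fin (d + 1)) :
    (solidMonogenicBasis d n : E3 → Cl3) = solidMonogenic n d := by
  rw [solidMonogenicBasis, Module.Basis.mk_apply, solidMonogenicFamily]

end SolidMonogenicBasis

section JacobiPolynomials

open Polynomial

theorem coeff_X_add_C_pow_mul_X_add_C_pow (m a b : ℕ) (r t : ℝ) :
    ((X + C (r * (t + 1) / 2)) ^ (m + a) * (X + C (r * (t - 1) / 2)) ^ (m + b)).coeff
      (m + a + b) = r ^ m * jacobiP m a b t := by
  simp only [coeff_mul, coeff_X_add_C_pow, jacobiP, Finset.mul_sum]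
  symm
  refine Finset.sum_of_injOn (fun s => (a + s, m + b - s)) ?_ ?_ ?_ ?_
  · intro s _ s' _ h
    simpa using congrArg Prod.fst h
  · intro s hs
    simp only [Finset.coe_range, Set.mem_Iio, Finset.mem_coe,
      Finset.HasAntidiagonal.mem_antidiagonal] at hs ⊢
    omega
  · rintro ⟨i, j⟩ hij hnot
    simp only [Finset.HasAntidiagonal.mem_antidiagonal] at hij
    by_cases hi : m + a < i
    · simp [Nat.choose_eq_zero_of_lt hi]
    · have hj : m + b < j := by
        by_contra hj
        exact hnot ⟨i - a, by simp; omega, by simp; omega⟩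
      simp [Nat.choose_eq_zero_of_lt hj]
  · intro s hs
    obtain ⟨l, rfl⟩ := Nat.exists_eq_add_of_le (Finset.mem_range_succ_iff.1 hs)
    have hleft : (s + l + a).choose (a + s) = (s + l + a).choose l :=
      Nat.choose_symm_of_eq_add (by ring)
    have hright : (s + l + b).choose (s + l + b - s) = (s + l + b).choose s :=
      Nat.choose_symm (by omega)
    have hl : s + l + a - (a + s) = l := by omega
    have hs' : s + l + b - (s + l + b - s) = s := by omega
    simp only [hleft, hright, hl, hs', Nat.add_sub_cancel_left, div_pow, mul_pow, pow_add, inv_pow]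
    field_simp

theorem coeff_quadratic_pow_eq_jacobiP (m n : ℕ) (r φ : ℝ) :
    ((X ^ 2 + C (r * Real.cos φ) * X - C ((r * Real.sin φ) ^ 2 / 4)) ^ (m + n)).coeff
      (m + n + n) = r ^ m * jacobiP m n n (Real.cos φ) := by
  have hfactor : (X ^ 2 + C (r * Real.cos φ) * X - C ((r * Real.sin φ) ^ 2 / 4) : ℝ[X]) =
      (X + C (r * (Real.cos φ + 1) / 2)) * (X + C (r * (Real.cos φ - 1) / 2)) := by
    have hsum : r * Real.cos φ = r * (Real.cos φ + 1) / 2 + r * (Real.cos φ - 1) / 2 := by ring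
    have hprod : -((r * Real.sin φ) ^ 2 / 4) =
        r * (Real.cos φ + 1) / 2 * (r * (Real.cos φ - 1) / 2) := by
      rw [mul_pow, Real.sin_sq]
      ring
    rw [sub_eq_add_neg, ← C_neg, hsum, hprod, C_add, C_mul]
    ring
  rw [hfactor, mul_pow, coeff_X_add_C_pow_mul_X_add_C_pow]

theorem solid_eq_conj_zeta_pow_mul (n d : ℕ) (x : E3) :
    solid n d x = conj (zeta x) ^ n / d.factorial *
      (((X ^ 2 + C (x 2) * X - C (‖zeta x‖ ^ 2 / 4)) ^ d).coeff (d + n) : ℝ) := by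
  have hmap : (X ^ 2 + C (x 2 : ℂ) * X + C (conj (zeta x) * -(zeta x / 4)) : ℂ[X]) =
      (X ^ 2 + C (x 2) * X - C (‖zeta x‖ ^ 2 / 4)).map Complex.ofRealHom := by
    rw [mul_neg, C_neg, ← sub_eq_add_neg, ← mul_div_assoc, Complex.conj_mul']
    simp
  rw [solid, genPoly_apply, sub_eq_add_neg, ← C_neg, coeff_quadratic_pow, hmap,
    ← Polynomial.map_pow, coeff_map, Complex.ofRealHom_eq_coe]
  ring

end JacobiPolynomials

section SphericalHarmonics

theorem norm_sq_eq (x : E3) : ‖x‖ ^ 2 = ‖zeta x‖ ^ 2 + x 2 ^ 2 := by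
  rw [EuclideanSpace.norm_sq_eq, Fin.sum_univ_three, Complex.sq_norm, Complex.normSq_apply]
  simp [zeta, sq]

theorem norm_mul_cos_polar (x : E3) : ‖x‖ * Real.cos (polar x) = x 2 := by
  have habs : |x 2 / ‖x‖| ≤ 1 := by
    rw [abs_div, abs_norm]
    exact div_le_one_of_le₀ (PiLp.norm_apply_le x 2) (norm_nonneg x)
  rw [polar, Real.cos_arccos (abs_le.1 habs).1 (abs_le.1 habs).2]
  refine mul_div_cancel_of_imp' fun h => ?_
  simp [norm_eq_zero.1 h]

theorem norm_mul_sin_polar (x : E3) : ‖x‖ * Real.sin (polar x) = ‖zeta x‖ := by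
  have hsin : 0 ≤ Real.sin (polar x) := Real.sin_nonneg_of_nonneg_of_le_pi
    (Real.arccos_nonneg _) (Real.arccos_le_pi _)
  refine (sq_eq_sq₀ (by positivity) (norm_nonneg _)).1 ?_
  rw [mul_pow, Real.sin_sq, mul_sub, mul_one, ← mul_pow, norm_mul_cos_polar, norm_sq_eq,
    add_sub_cancel_right]

theorem conj_zeta_pow_eq (n : ℕ) (x : E3) :
    conj (zeta x) ^ n = (‖x‖ * Real.sin (polar x) : ℝ) ^ n *
      (Real.cos (n * azimuth x) - Complex.I * Real.sin (n * azimuth x)) := by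
  have hpolar : conj (zeta x) = (‖x‖ * Real.sin (polar x) : ℝ) *
      (Complex.cos (-azimuth x) + Complex.sin (-azimuth x) * Complex.I) := by
    rw [norm_mul_sin_polar, Complex.cos_neg, Complex.sin_neg, neg_mul]
    conv_lhs => rw [← Complex.norm_mul_cos_add_sin_mul_I (zeta x)]
    simp only [map_mul, map_add, Complex.conj_ofReal, ← Complex.cos_conj, ← Complex.sin_conj,
      Complex.conj_I, mul_neg]
    rfl
  rw [hpolar, mul_pow, Complex.cos_add_sin_mul_I_pow, mul_neg, Complex.cos_neg, Complex.sin_neg]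
  push_cast
  ring

theorem solid_eq_jacobiP {n d : ℕ} (h : n ≤ d) (x : E3) :
    solid n d x = (‖x‖ ^ d * Real.sin (polar x) ^ n *
      jacobiP (d - n) n n (Real.cos (polar x)) / d.factorial : ℝ) *
        (Real.cos (n * azimuth x) - Complex.I * Real.sin (n * azimuth x)) := by
  obtain ⟨m, rfl⟩ := Nat.exists_eq_add_of_le' h
  rw [solid_eq_conj_zeta_pow_mul, ← norm_mul_sin_polar, ← norm_mul_cos_polar,
    coeff_quadratic_pow_eq_jacobiP, conj_zeta_pow_eq, Nat.add_sub_cancel]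
  push_cast
  ring

/-- The denominators normalizing the harmonics `H_k^{2n}` and `H_k^{2n+1}`. -/
def harmonicNormalization (n : ℕ) : ℝ :=
  if n = 0 then √(8 * Real.pi) else 2 ^ (n + 1) * √Real.pi

theorem harmonicNormalization_ne_zero (n : ℕ) : harmonicNormalization n ≠ 0 := by
  unfold harmonicNormalization
  split_ifs <;> positivity

theorem harmonic_two_mul (k n : ℕ) (x : E3) :
    harmonic k (2 * n) x = ‖x‖ ^ k * Real.sin (polar x) ^ n *
      jacobiP (k - n) n n (Real.cos (polar x)) / harmonicNormalization n *
        Real.cos (n * azimuth x) := by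
  rcases eq_or_ne n 0 with rfl | hn
  · simp [harmonic, harmonicNormalization, div_mul_eq_mul_div]
  · simp only [harmonic, harmonicNormalization, hn, if_false, mul_eq_zero, OfNat.ofNat_ne_zero,
      or_self, even_two_mul, if_true, Nat.mul_div_cancel_left n two_pos]
    ring

theorem harmonic_two_mul_add_one (k n : ℕ) (x : E3) :
    harmonic k (2 * n + 1) x = ‖x‖ ^ k * Real.sin (polar x) ^ n *
      jacobiP (k - n) n n (Real.cos (polar x)) / harmonicNormalization n *
        Real.sin (n * azimuth x) := by
  have hhalf : (2 * n + 1) / 2 = n := by omega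
  rcases eq_or_ne n 0 with rfl | hn
  · simp [harmonic]
  · simp only [harmonic, harmonicNormalization, hn, hhalf, if_false, Nat.succ_ne_zero,
      Nat.not_even_two_mul_add_one]
    ring

/-- The factor relating the harmonics of degree `k` and order `n` to `solid n k`. -/
def harmonicConst (k n : ℕ) : ℝ := k.factorial / harmonicNormalization n

theorem harmonicConst_ne_zero (k n : ℕ) : harmonicConst k n ≠ 0 :=
  div_ne_zero (Nat.cast_ne_zero.2 k.factorial_ne_zero) (harmonicNormalization_ne_zero n)

theorem harmonicConst_smul_solid {k n : ℕ} (h : n ≤ k) (x : E3) :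
    harmonicConst k n • solid n k x =
      harmonic k (2 * n) x - Complex.I * harmonic k (2 * n + 1) x := by
  have hk : (k.factorial : ℂ) ≠ 0 := Nat.cast_ne_zero.2 k.factorial_ne_zero
  rw [harmonic_two_mul, harmonic_two_mul_add_one, solid_eq_jacobiP h, harmonicConst,
    Complex.real_smul]
  push_cast
  field_simp

theorem harmonic_two_mul_eq_re {k n : ℕ} (h : n ≤ k) (x : E3) :
    harmonic k (2 * n) x = harmonicConst k n * (solid n k x).re := by
  simpa using (congrArg Complex.re (harmonicConst_smul_solid h x)).symm

theorem harmonic_two_mul_add_one_eq_neg_im {k n : ℕ} (h : n ≤ k) (x : E3) :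
    harmonic k (2 * n + 1) x = -(harmonicConst k n * (solid n k x).im) := by
  simpa using congrArg (-·) (congrArg Complex.im (harmonicConst_smul_solid h x)).symm

end SphericalHarmonics

theorem algebraMap_sub_algebraMap_mul (a b : ℝ) :
    algebraMap ℝ Cl3 a - algebraMap ℝ Cl3 b * (e 0 * e 1) = cplx (a - Complex.I * b) := by
  rw [cplx_apply]
  simp [Algebra.smul_def, sub_eq_add_neg]

theorem monogenicF_succ_apply {n d : ℕ} (h : n ≤ d) (x : E3) :
    monogenicF (d + 1) n x = harmonicConst (d + 1) n • solidMonogenic n d x := by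
  have hn : n ≤ d + 1 := h.trans d.le_succ
  have hsolid := differentiableAt_solid n (d + 1) x
  have hre : DifferentiableAt ℝ (fun y => algebraMap ℝ Cl3 (harmonic (d + 1) (2 * n) y)) x := by
    simp only [harmonic_two_mul_eq_re hn]
    exact (algebraMapCLM ℝ Cl3).differentiableAt.comp x
      ((Complex.reCLM.differentiableAt.comp x hsolid).const_mul _)
  have him : DifferentiableAt ℝ (fun y => algebraMap ℝ Cl3 (harmonic (d + 1) (2 * n + 1) y)) x := by
    simp only [harmonic_two_mul_add_one_eq_neg_im hn]
    exact (algebraMapCLM ℝ Cl3).differentiableAt.comp x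
      ((Complex.imCLM.differentiableAt.comp x hsolid).const_mul _).neg
  have hcplx : DifferentiableAt ℝ (fun y => cplx (solid n (d + 1) y)) x :=
    cplxL.differentiableAt.comp x hsolid
  have himR : DifferentiableAt ℝ
      (fun y => algebraMap ℝ Cl3 (harmonic (d + 1) (2 * n + 1) y) * (e 0 * e 1)) x :=
    (mulRightL (e 0 * e 1)).differentiableAt.comp x him
  rw [monogenicF, diracHarmonic, diracHarmonic, ← dirac_mul_const him, ← dirac_sub hre himR]
  simp only [algebraMap_sub_algebraMap_mul, ← harmonicConst_smul_solid hn, map_smul]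
  simp only [Algebra.smul_def, Algebra.commutes]
  rw [dirac_mul_const hcplx, dirac_cplx_solid]

section SphereIsometry

variable {E F : Type*} [NormedAddCommGroup E] [NormedSpace ℝ E] [NormedAddCommGroup F]
  [NormedSpace ℝ F]

/-- The homeomorphism of unit spheres induced by a linear isometry equivalence. -/
def sphereHomeomorph (f : E ≃ₗᵢ[ℝ] F) : Metric.sphere (0 : E) 1 ≃ₜ Metric.sphere (0 : F) 1 :=
  f.toHomeomorph.subtype (by simp)

theorem coe_sphereHomeomorph (f : E ≃ₗᵢ[ℝ] F) (x : Metric.sphere (0 : E) 1) :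
    (sphereHomeomorph f x : F) = f x := rfl

theorem preimage_smul_coe_image (f : E ≃ₗᵢ[ℝ] F) (t : Set ℝ) (s : Set (Metric.sphere (0 : F) 1)) :
    f ⁻¹' (t • ((↑) '' s : Set F)) = t • ((↑) '' (sphereHomeomorph f ⁻¹' s) : Set E) := by
  ext y
  simp only [Set.mem_preimage, Set.mem_smul, Set.mem_image]
  constructor
  · rintro ⟨c, hc, _, ⟨x, hx, rfl⟩, hy⟩
    refine ⟨c, hc, _, ⟨(sphereHomeomorph f).symm x, by simpa using hx, rfl⟩, f.injective ?_⟩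
    rw [map_smul, ← coe_sphereHomeomorph, Homeomorph.apply_symm_apply, hy]
  · rintro ⟨c, hc, _, ⟨x, hx, rfl⟩, rfl⟩
    exact ⟨c, hc, _, ⟨_, hx, rfl⟩, (map_smul f c _).symm⟩

theorem measurePreserving_sphereHomeomorph [MeasurableSpace E] [BorelSpace E]
    [FiniteDimensional ℝ E] [MeasurableSpace F] [BorelSpace F] [FiniteDimensional ℝ F]
    {μ : Measure E} {ν : Measure F} (f : E ≃ₗᵢ[ℝ] F) (hf : MeasurePreserving f μ ν) :
    MeasurePreserving (sphereHomeomorph f) μ.toSphere ν.toSphere := by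
  have hmeas := (sphereHomeomorph f).continuous.measurable
  refine ⟨hmeas, Measure.ext fun s hs => ?_⟩
  rw [Measure.map_apply hmeas hs, Measure.toSphere_apply' _ (hmeas hs),
    Measure.toSphere_apply' _ hs, ← preimage_smul_coe_image,
    hf.measure_preimage_emb f.toHomeomorph.measurableEmbedding, f.toLinearEquiv.finrank_eq]

end SphereIsometry

section AzimuthalWeight

/-- The rotation about the third axis that multiplies `x₁ + i x₂` by the unit complex number `u`. -/
def rotation (u : Circle) : E3 ≃ₗᵢ[ℝ] E3 :=
  LinearIsometry.toLinearIsometryEquiv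
    { toFun := fun x => !₂[(u * zeta x).re, (u * zeta x).im, x 2]
      map_add' := fun x y => by
        ext i
        fin_cases i <;> simp [zeta] <;> ring
      map_smul' := fun t x => by
        ext i
        fin_cases i <;> simp [zeta] <;> ring
      norm_map' := fun x => by
        refine (sq_eq_sq₀ (norm_nonneg _) (norm_nonneg _)).1 ?_
        have hzeta : zeta !₂[(u * zeta x).re, (u * zeta x).im, x 2] = u * zeta x := rfl
        change ‖(!₂[(u * zeta x).re, (u * zeta x).im, x 2] : E3)‖ ^ 2 = _
        rw [norm_sq_eq, norm_sq_eq, hzeta, norm_mul, Circle.norm_coe, one_mul]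
        rfl } rfl

theorem zeta_rotation (u : Circle) (x : E3) : zeta (rotation u x) = u * zeta x := rfl

theorem rotation_apply_two (u : Circle) (x : E3) : rotation u x 2 = x 2 := rfl

/-- `g` picks up the factor `u ^ k` under rotations by `u` about the third axis; equivalently its
dependence on the azimuth `θ` is through `e ^ (i k θ)`. -/
def HasAzimuthalWeight (k : ℤ) (g : E3 → ℂ) : Prop :=
  ∀ (u : Circle) (x : E3), g (rotation u x) = (u ^ k : Circle) * g x

namespace HasAzimuthalWeight

variable {k l : ℤ} {g h : E3 → ℂ}

theorem add (hg : HasAzimuthalWeight k g) (hh : HasAzimuthalWeight k h) :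
    HasAzimuthalWeight k fun x => g x + h x := fun u x => by
  beta_reduce
  rw [hg, hh, mul_add]

theorem sub (hg : HasAzimuthalWeight k g) (hh : HasAzimuthalWeight k h) :
    HasAzimuthalWeight k fun x => g x - h x := fun u x => by
  beta_reduce
  rw [hg, hh, mul_sub]

theorem const_mul (c : ℂ) (hg : HasAzimuthalWeight k g) :
    HasAzimuthalWeight k fun x => c * g x := fun u x => by
  beta_reduce
  rw [hg, mul_left_comm]

theorem mul (hg : HasAzimuthalWeight k g) (hh : HasAzimuthalWeight l h) :
    HasAzimuthalWeight (k + l) fun x => g x * h x := fun u x => by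
  beta_reduce
  rw [hg, hh, mul_mul_mul_comm, zpow_add, Circle.coe_mul]

theorem conj_comp (hg : HasAzimuthalWeight k g) :
    HasAzimuthalWeight (-k) fun x => conj (g x) := fun u x => by
  beta_reduce
  rw [hg, map_mul, ← Circle.coe_inv_eq_conj, zpow_neg]

theorem integral_eq_zero (hg : HasAzimuthalWeight k g) (hk : k ≠ 0) :
    ∫ ω : Metric.sphere (0 : E3) 1, g ω ∂surfaceMeasure = 0 := by
  have hweight : ((Circle.exp (Real.pi / k) ^ k : Circle) : ℂ) ≠ 1 := by
    rw [← Circle.exp_intCast_mul, mul_div_cancel₀ _ (Int.cast_ne_zero.2 hk)]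
    exact mt Circle.coe_eq_one.1 Circle.exp_pi_ne_one
  have hinvariant := (measurePreserving_sphereHomeomorph (rotation (Circle.exp (Real.pi / k)))
    (LinearIsometryEquiv.measurePreserving _)).integral_comp
      (Homeomorph.measurableEmbedding _) fun ω => g ω
  simp only [coe_sphereHomeomorph, hg _ _, integral_const_mul] at hinvariant
  exact (mul_left_eq_self₀.1 hinvariant).resolve_left hweight

end HasAzimuthalWeight

theorem hasAzimuthalWeight_solid (n d : ℕ) : HasAzimuthalWeight (-n) (solid n d) := fun u x => by
  rw [solid_eq_conj_zeta_pow_mul, solid_eq_conj_zeta_pow_mul, zeta_rotation, rotation_apply_two,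
    norm_mul, Circle.norm_coe, one_mul, map_mul, mul_pow, ← Circle.coe_inv_eq_conj, zpow_neg,
    zpow_natCast, ← inv_pow, Circle.coe_pow]
  ring

end AzimuthalWeight

section Orthogonality

theorem star_solidMonogenic (n d : ℕ) (x : E3) : star (solidMonogenic n d x) =
    e 0 * cplx (1 / 2 * solid (n + 1) d x) - e 2 * cplx (conj (solid n d x)) := by
  rw [solidMonogenic, star_sub, star_mul, star_mul, star_e, star_e, star_cplx, star_cplx, mul_neg,
    mul_neg, cplx_mul_e_two, cplx_mul_e_zero, Complex.conj_conj, sub_neg_eq_add, neg_add_eq_sub]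

theorem mul_cplx_sub_mul_mul_cplx_sub (a b a' b' : ℂ) :
    (e 0 * cplx b - e 2 * cplx a) * (e 2 * cplx a' - e 0 * cplx b') =
      cplx (a * a' + conj b * b') + e 0 * e 2 * cplx (b * a' - conj a * b') := by
  have h20 : e 2 * e 0 = -(e 0 * e 2) := e_anticomm (by decide)
  have htwo (a b : ℂ) : cplx a * (e 2 * cplx b) = e 2 * cplx (a * b) := by
    rw [← mul_assoc, cplx_mul_e_two, mul_assoc, map_mul]
  have hzero (a b : ℂ) : cplx a * (e 0 * cplx b) = e 0 * cplx (conj a * b) := by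
    rw [← mul_assoc, cplx_mul_e_zero, mul_assoc, map_mul]
  simp only [sub_mul, mul_sub, mul_assoc, htwo, hzero]
  simp only [← mul_assoc, e_sq, h20, neg_mul, one_mul, map_sub, map_add, mul_sub]
  abel

/-- The scalar and `e₁₂` part of `star (solidMonogenic n d x) * solidMonogenic m d x`. -/
def innerDiag (n m d : ℕ) (x : E3) : ℂ :=
  conj (solid n d x) * solid m d x + 1 / 4 * (conj (solid (n + 1) d x) * solid (m + 1) d x)

/-- The `e₁₃` and `e₂₃` part of `star (solidMonogenic n d x) * solidMonogenic m d x`. -/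
def innerOffDiag (n m d : ℕ) (x : E3) : ℂ :=
  1 / 2 * (solid (n + 1) d x * solid m d x - solid n d x * solid (m + 1) d x)

theorem star_solidMonogenic_mul (n m d : ℕ) (x : E3) :
    star (solidMonogenic n d x) * solidMonogenic m d x =
      cplx (innerDiag n m d x) + e 0 * e 2 * cplx (innerOffDiag n m d x) := by
  rw [star_solidMonogenic, solidMonogenic, mul_cplx_sub_mul_mul_cplx_sub, innerDiag, innerOffDiag]
  have hdiag : conj (1 / 2 * solid (n + 1) d x) * (1 / 2 * solid (m + 1) d x) =
      1 / 4 * (conj (solid (n + 1) d x) * solid (m + 1) d x) := by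
    rw [map_mul, map_div₀, map_one, map_ofNat]
    ring
  have hoff : 1 / 2 * solid (n + 1) d x * solid m d x -
      conj (conj (solid n d x)) * (1 / 2 * solid (m + 1) d x) =
        1 / 2 * (solid (n + 1) d x * solid m d x - solid n d x * solid (m + 1) d x) := by
    rw [Complex.conj_conj]
    ring
  rw [hdiag, hoff]

theorem continuous_innerDiag (n m d : ℕ) : Continuous (innerDiag n m d) := by
  have hsolid (n : ℕ) : Continuous (solid n d) := (contDiff_solid (m := 0) n d).continuous
  unfold innerDiag
  fun_prop

theorem continuous_innerOffDiag (n m d : ℕ) : Continuous (innerOffDiag n m d) := by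
  have hsolid (n : ℕ) : Continuous (solid n d) := (contDiff_solid (m := 0) n d).continuous
  unfold innerOffDiag
  fun_prop

theorem hasAzimuthalWeight_innerDiag (n m d : ℕ) :
    HasAzimuthalWeight (n - m) (innerDiag n m d) := by
  have hproduct (n m : ℕ) :
      HasAzimuthalWeight (n - m) fun x => conj (solid n d x) * solid m d x := by
    simpa [sub_eq_add_neg] using
      (hasAzimuthalWeight_solid n d).conj_comp.mul (hasAzimuthalWeight_solid m d)
  have hsucc := hproduct (n + 1) (m + 1)
  push_cast [add_sub_add_right_eq_sub] at hsucc
  exact (hproduct n m).add (hsucc.const_mul _)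

theorem hasAzimuthalWeight_innerOffDiag (n m d : ℕ) :
    HasAzimuthalWeight (-(n + m + 1)) (innerOffDiag n m d) := by
  have hfirst := (hasAzimuthalWeight_solid (n + 1) d).mul (hasAzimuthalWeight_solid m d)
  have hsecond := (hasAzimuthalWeight_solid n d).mul (hasAzimuthalWeight_solid (m + 1) d)
  have hweight₁ : -((n + 1 : ℕ) : ℤ) + -m = -(n + m + 1) := by push_cast; ring
  have hweight₂ : -(n : ℤ) + -((m + 1 : ℕ) : ℤ) = -(n + m + 1) := by push_cast; ring
  rw [hweight₁] at hfirst
  rw [hweight₂] at hsecond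
  exact (hfirst.sub hsecond).const_mul _

theorem integrable_toSphere {E F : Type*} [NormedAddCommGroup E] [NormedSpace ℝ E]
    [FiniteDimensional ℝ E] [MeasurableSpace E] [BorelSpace E] {μ : Measure E} [μ.IsAddHaarMeasure]
    [NormedAddCommGroup F] {g : E → F} (hg : Continuous g) :
    Integrable (fun ω : Metric.sphere (0 : E) 1 => g ω) μ.toSphere :=
  (hg.comp continuous_subtype_val).integrable_of_hasCompactSupport
    (HasCompactSupport.of_compactSpace _)

theorem integrable_star_solidMonogenic_mul (n m d : ℕ) :
    Integrable (fun ω : Metric.sphere (0 : E3) 1 =>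
      star (solidMonogenic n d ω) * solidMonogenic m d ω) surfaceMeasure := by
  simp only [star_solidMonogenic_mul]
  exact integrable_toSphere ((cplxL.continuous.comp (continuous_innerDiag n m d)).add
    (((mulLeftL (e 0 * e 2)).comp cplxL).continuous.comp (continuous_innerOffDiag n m d)))

theorem integral_star_solidMonogenic_mul {n m : ℕ} (h : n ≠ m) (d : ℕ) :
    ∫ ω : Metric.sphere (0 : E3) 1,
      star (solidMonogenic n d ω) * solidMonogenic m d ω ∂surfaceMeasure = 0 := by
  have hcomplete : CompleteSpace Cl3 := FiniteDimensional.complete ℝ Cl3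
  have hdiag := integrable_toSphere (μ := volume) (continuous_innerDiag n m d)
  have hoff := integrable_toSphere (μ := volume) (continuous_innerOffDiag n m d)
  calc ∫ ω : Metric.sphere (0 : E3) 1,
        star (solidMonogenic n d ω) * solidMonogenic m d ω ∂surfaceMeasure
    _ = ∫ ω : Metric.sphere (0 : E3) 1, cplxL (innerDiag n m d ω) +
          (mulLeftL (e 0 * e 2)).comp cplxL (innerOffDiag n m d ω) ∂surfaceMeasure := by
      simp only [star_solidMonogenic_mul]
      rfl
    _ = cplxL (∫ ω : Metric.sphere (0 : E3) 1, innerDiag n m d ω ∂surfaceMeasure) +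
          (mulLeftL (e 0 * e 2)).comp cplxL
            (∫ ω : Metric.sphere (0 : E3) 1, innerOffDiag n m d ω ∂surfaceMeasure) := by
      rw [integral_add (cplxL.integrable_comp hdiag)
        (((mulLeftL (e 0 * e 2)).comp cplxL).integrable_comp hoff),
        ContinuousLinearMap.integral_comp_comm _ hdiag,
        ContinuousLinearMap.integral_comp_comm _ hoff]
    _ = 0 := by
      rw [(hasAzimuthalWeight_innerDiag n m d).integral_eq_zero
          (sub_ne_zero.2 (Nat.cast_injective.ne h)),
        (hasAzimuthalWeight_innerOffDiag n m d).integral_eq_zero (by omega), map_zero, map_zero,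
        add_zero]

end Orthogonality

section MonogenicF

theorem star_monogenicF_succ_mul {n m d : ℕ} (hn : n ≤ d) (hm : m ≤ d) (x : E3) :
    star (monogenicF (d + 1) n x) * monogenicF (d + 1) m x =
      (harmonicConst (d + 1) n * harmonicConst (d + 1) m) •
        (star (solidMonogenic n d x) * solidMonogenic m d x) := by
  rw [monogenicF_succ_apply hn, monogenicF_succ_apply hm, CliffordAlgebra.star_smul,
    smul_mul_smul_comm]

theorem integrable_star_monogenicF_mul {n m d : ℕ} (hn : n ≤ d) (hm : m ≤ d) :
    Integrable (fun ω : Metric.sphere (0 : E3) 1 =>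
      star (monogenicF (d + 1) n ω) * monogenicF (d + 1) m ω) surfaceMeasure := by
  simp only [star_monogenicF_succ_mul hn hm]
  exact (integrable_star_solidMonogenic_mul n m d).smul (_ : ℝ)

theorem integral_star_monogenicF_mul {n m d : ℕ} (hn : n ≤ d) (hm : m ≤ d) (h : n ≠ m) :
    ∫ ω : Metric.sphere (0 : E3) 1,
      star (monogenicF (d + 1) n ω) * monogenicF (d + 1) m ω ∂surfaceMeasure = 0 := by
  simp only [star_monogenicF_succ_mul hn hm]
  rw [integral_smul, integral_star_solidMonogenic_mul h, smul_zero]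

theorem isUnit_op_algebraMap_harmonicConst (k n : ℕ) :
    IsUnit (MulOpposite.op (algebraMap ℝ Cl3 (harmonicConst k n))) :=
  ((harmonicConst_ne_zero k n).isUnit.map (algebraMap ℝ Cl3)).op

/-- The functions `F_d^0, …, F_d^d` as a basis of the right `ℝ₃`-module `monogenics d`. -/
def monogenicFBasis (d : ℕ) : Module.Basis (Fin (d + 1)) Cl3ᵐᵒᵖ (monogenics d) :=
  (solidMonogenicBasis d).isUnitSMul fun n => isUnit_op_algebraMap_harmonicConst (d + 1) n

theorem coe_monogenicFBasis_apply (d : ℕ) (n : Fin (d + 1)) :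
    (monogenicFBasis d n : E3 → Cl3) = monogenicF (d + 1) n := by
  funext x
  rw [monogenicFBasis, Module.Basis.isUnitSMul_apply, Submodule.coe_smul,
    coe_solidMonogenicBasis_apply, Pi.smul_apply, op_smul_eq_mul,
    monogenicF_succ_apply n.is_le, Algebra.smul_def, Algebra.commutes]

end MonogenicF

end SphMon

end

theorem mainTheorem1 (k : ℕ) (hk : 1 ≤ k) :
    (∀ n n' : Fin k, n ≠ n' →
      Integrable (fun ω : Metric.sphere (0 : SphMon.E3) 1 =>
        star (SphMon.monogenicF k n ω) * SphMon.monogenicF k n' ω) SphMon.surfaceMeasure ∧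
      ∫ ω : Metric.sphere (0 : SphMon.E3) 1,
        star (SphMon.monogenicF k n ω) * SphMon.monogenicF k n' ω ∂SphMon.surfaceMeasure = 0) ∧
    ∃ b : Module.Basis (Fin k) SphMon.Cl3ᵐᵒᵖ (SphMon.monogenics (k - 1)),
      ∀ n : Fin k, (b n : SphMon.E3 → SphMon.Cl3) = SphMon.monogenicF k n := by
  obtain ⟨d, rfl⟩ := Nat.exists_eq_add_of_le' hk
  exact ⟨fun n n' hne => ⟨SphMon.integrable_star_monogenicF_mul n.is_le n'.is_le,
      SphMon.integral_star_monogenicF_mul n.is_le n'.is_le (Fin.val_injective.ne hne)⟩,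
    SphMon.monogenicFBasis d, SphMon.coe_monogenicFBasis_apply d⟩
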